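/- Let $p\ge 2$ be an integer, let $\zeta\in\mathbb C$ be a primitive $p$-th root of unity, and let $\mathfrak u,\mathfrak v\in M_p(\mathbb C)$ be the Weyl unitaries: $\mathfrak u=\mathrm{diag}(1,\zeta,\dots,\zeta^{p-1})$, and $\mathfrak v$ is the cyclic shift $\mathfrak v e_j=e_{j+1 \bmod p}$ of the standard basis $e_0,\dots,e_{p-1}$ of $\mathbb C^p$. Let $\mathcal O=\mathrm{Span}_{\mathbb C}\{1,\mathfrak u,\mathfrak u^*,\mathfrak v,\mathfrak v^*\}$ and let $W(\mathfrak u,\mathfrak v)=(W^n)_{n\ge 1}$ be the matrix range, where $$W^n=\{(\psi(\mathfrak u),\psi(\mathfrak v)) : \psi:\mathcal O\to M_n(\mathbb C)\text{ linear, unital and completely positive}\}.$$ Then $(\mathfrak u,\mathfrak v)$ is a matrix extreme point of $W(\mathfrak u,\mathfrak v)$. That is, $W(\mathfrak u,\mathfrak v)$ is matrix convex (for all $m$ and all $n,n_1,\dots,n_m\ge1$, $\sum_{j=1}^m\gamma_j^*a_j\gamma_j\in W^n$ whenever $a_j\in W^{n_j}$ and the linear maps $\gamma_j:\mathbb C^n\to\mathbb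 C^{n_j}$ satisfy $\sum_{j=1}^m\gamma_j^*\gamma_j=1_n$), $(\mathfrak u,\mathfrak v)\in W^p$, and whenever $$(\mathfrak u,\mathfrak v)=\sum_{j=1}^m\gamma_j^*a_j\gamma_j$$ with $n_j\ge1$, $a_j\in W^{n_j}$, and surjective linear maps $\gamma_j:\mathbb C^p\to\mathbb C^{n_j}$ such that $\sum_{j=1}^m\gamma_j^*\gamma_j=1_p$, then for every $j$ one has $n_j=p$ and there is a unitary $w_j\in M_p(\mathbb C)$ with $(\mathfrak u,\mathfrak v)=w_j^*a_jw_j$. (Products $\gamma^*a\gamma$ of a pair $a$ are taken componentwise.) -/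

import Mathlib

namespace WeylUnitaries

open Matrix
open scoped ComplexOrder

/-- A `g`-tuple of complex `n × n` matrices. -/
abbrev MatTuple (g n : ℕ) : Type := Fin g → Matrix (Fin n) (Fin n) ℂ

/-- The diagonal Weyl unitary `diag(1, ζ, ζ², …, ζ^(p-1))`. -/
def weylU (p : ℕ) (ζ : ℂ) : Matrix (Fin p) (Fin p) ℂ :=
  Matrix.diagonal fun i => ζ ^ (i : ℕ)

/-- The cyclic shift matrix, sending the basis vector `e_j` to `e_(j+1 mod p)`. -/
def weylV (p : ℕ) : Matrix (Fin p) (Fin p) ℂ :=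
  Matrix.of fun i j => if (i : ℕ) = ((j : ℕ) + 1) % p then 1 else 0

/-- The Weyl pair `(𝔲, 𝔳)`. -/
def weylPair (p : ℕ) (ζ : ℂ) : MatTuple 2 p :=
  ![weylU p ζ, weylV p]

/-- The operator system of a tuple `x`: the complex span of `1`, the `x_k` and the `x_k^*`. -/
def operatorSystem {g d : ℕ} (x : MatTuple g d) : Submodule ℂ (Matrix (Fin d) (Fin d) ℂ) :=
  Submodule.span ℂ ({1} ∪ Set.range x ∪ Set.range fun k => (x k)ᴴ)

theorem one_mem_operatorSystem {g d : ℕ} (x : MatTuple g d) : 1 ∈ operatorSystem x :=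
  Submodule.subset_span (Or.inl (Or.inl rfl))

theorem mem_operatorSystem {g d : ℕ} (x : MatTuple g d) (k : Fin g) : x k ∈ operatorSystem x :=
  Submodule.subset_span (Or.inl (Or.inr ⟨k, rfl⟩))

/-- Complete positivity of a linear map on a subspace `S` of `M_d(ℂ)`: for every `k`, applying `φ`
entrywise sends positive elements of `M_k(S)` to positive elements of `M_k(M_n(ℂ))`. Positivity is
that of the `kd × kd` and `kn × kn` complex matrices obtained by forgetting the blocks. -/
def IsCompletelyPositive {d n : ℕ} {S : Submodule ℂ (Matrix (Fin d) (Fin d) ℂ)}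
    (φ : S →ₗ[ℂ] Matrix (Fin n) (Fin n) ℂ) : Prop :=
  ∀ (k : ℕ) (M : Matrix (Fin k) (Fin k) S),
    (Matrix.comp (Fin k) (Fin k) (Fin d) (Fin d) ℂ
      (M.map fun s => (s : Matrix (Fin d) (Fin d) ℂ))).PosSemidef →
    (Matrix.comp (Fin k) (Fin k) (Fin n) (Fin n) ℂ (M.map fun s => φ s)).PosSemidef

/-- The `n`-th matrix range `W^n(x)`: the tuples `(ψ(x_1), …, ψ(x_g))` with `ψ` a unital completely
positive linear map from the operator system of `x` into `M_n(ℂ)`. -/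
def matrixRange {g d : ℕ} (x : MatTuple g d) (n : ℕ) : Set (MatTuple g n) :=
  {a | ∃ ψ : operatorSystem x →ₗ[ℂ] Matrix (Fin n) (Fin n) ℂ,
    IsCompletelyPositive ψ ∧ ψ ⟨1, one_mem_operatorSystem x⟩ = 1 ∧
      ∀ k, a k = ψ ⟨x k, mem_operatorSystem x k⟩}

/-- The matrices `γ_j`, as linear maps `ℂ^n → ℂ^(n_j)`, are matrix convex coefficients. -/
def IsMatrixConvexCoeff {m n : ℕ} {s : Fin m → ℕ}
    (γ : ∀ j, Matrix (Fin (s j)) (Fin n) ℂ) : Prop :=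
  ∑ j, (γ j)ᴴ * γ j = 1

/-- The tuple `∑ j, γ_j^* a_j γ_j`. -/
def matrixCombination {g m n : ℕ} {s : Fin m → ℕ}
    (γ : ∀ j, Matrix (Fin (s j)) (Fin n) ℂ) (a : ∀ j, MatTuple g (s j)) : MatTuple g n :=
  fun k => ∑ j, (γ j)ᴴ * a j k * γ j

/-- Matrix convexity of a sequence `K = (K_n)`; only the sizes `n ≥ 1` matter. -/
def IsMatrixConvex {g : ℕ} (K : ∀ n : ℕ, Set (MatTuple g n)) : Prop :=
  ∀ (m n : ℕ) (s : Fin m → ℕ), 0 < n → (∀ j, 0 < s j) →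
    ∀ (γ : ∀ j, Matrix (Fin (s j)) (Fin n) ℂ) (a : ∀ j, MatTuple g (s j)),
      IsMatrixConvexCoeff γ → (∀ j, a j ∈ K (s j)) → matrixCombination γ a ∈ K n

/-- Unitary equivalence of two tuples of matrices: the sizes agree and `b = w^* a w` for a
unitary `w`. -/
def UnitarilyEquivalent {g d n : ℕ} (a : MatTuple g d) (b : MatTuple g n) : Prop :=
  ∃ h : d = n, ∃ w ∈ Matrix.unitaryGroup (Fin n) ℂ,
    ∀ k, b k = wᴴ * Matrix.reindex (finCongr h) (finCongr h) (a k) * w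

/-- `b ∈ K_n` is a matrix extreme point of the matrix convex sequence `K = (K_n)`, `n ≥ 1`. -/
structure IsMatrixExtremePoint {g n : ℕ} (K : ∀ n : ℕ, Set (MatTuple g n))
    (b : MatTuple g n) : Prop where
  convex : IsMatrixConvex K
  pos : 0 < n
  mem : b ∈ K n
  extreme : ∀ (m : ℕ) (s : Fin m → ℕ), (∀ j, 0 < s j) →
    ∀ (γ : ∀ j, Matrix (Fin (s j)) (Fin n) ℂ) (a : ∀ j, MatTuple g (s j)),
      IsMatrixConvexCoeff γ → (∀ j, a j ∈ K (s j)) →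
      (∀ j, Function.Surjective (γ j).mulVec) →
      b = matrixCombination γ a → ∀ j, s j = n ∧ UnitarilyEquivalent (a j) b

end WeylUnitaries

namespace WeylUnitaries

open Matrix
open scoped ComplexOrder

/-! Unitaries are extreme among contractions, and the Weyl pair is irreducible. Unital completely
positive maps send `𝔲` and `𝔳` to contractions. When a unitary is a matrix convex combination of
contractions, the defects in `intertwines_of_sum_conj_eq` are positive and sum to zero, so each
`γ_j` intertwines and `γ_j^* γ_j` commutes with `𝔲` and `𝔳`. By irreducibility `γ_j^* γ_j` is a
scalar, so the surjective `γ_j` is a multiple of a unitary. -/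

/-- Amplifying a compression by `c` gives the compression by `1 ⊗ c`, which preserves positivity. -/
theorem comp_map_conj {k d n : ℕ} (M : Matrix (Fin k) (Fin k) (Matrix (Fin d) (Fin d) ℂ))
    (c : Matrix (Fin d) (Fin n) ℂ) :
    Matrix.comp (Fin k) (Fin k) (Fin n) (Fin n) ℂ (M.map fun s => cᴴ * s * c) =
      (kroneckerMap (· * ·) (1 : Matrix (Fin k) (Fin k) ℂ) c)ᴴ *
        Matrix.comp (Fin k) (Fin k) (Fin d) (Fin d) ℂ M *
        kroneckerMap (· * ·) (1 : Matrix (Fin k) (Fin k) ℂ) c := by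
  ext ⟨i, i'⟩ ⟨j, j'⟩
  simp [Matrix.mul_apply, Fintype.sum_prod_type, Matrix.one_apply, ite_mul,
    Finset.sum_ite_irrel, apply_ite star]

theorem isCompletelyPositive_sum_conj {m d n : ℕ} {s : Fin m → ℕ}
    {S : Submodule ℂ (Matrix (Fin d) (Fin d) ℂ)}
    {ψ : ∀ j, S →ₗ[ℂ] Matrix (Fin (s j)) (Fin (s j)) ℂ} (hψ : ∀ j, IsCompletelyPositive (ψ j))
    (γ : ∀ j, Matrix (Fin (s j)) (Fin n) ℂ) {φ : S →ₗ[ℂ] Matrix (Fin n) (Fin n) ℂ}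
    (hφ : ∀ x, φ x = ∑ j, (γ j)ᴴ * ψ j x * γ j) : IsCompletelyPositive φ := by
  intro k M hM
  have key : Matrix.comp (Fin k) (Fin k) (Fin n) (Fin n) ℂ (M.map fun s => φ s) =
      ∑ j, Matrix.comp (Fin k) (Fin k) (Fin n) (Fin n) ℂ
        ((M.map fun s => ψ j s).map fun s => (γ j)ᴴ * s * γ j) := by
    ext ⟨i, i'⟩ ⟨j, j'⟩
    simp [hφ, Matrix.sum_apply]
  rw [key]
  refine Matrix.posSemidef_sum _ fun j _ => ?_
  rw [comp_map_conj]
  exact (hψ j k M hM).conjTranspose_mul_mul_same _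

theorem isMatrixConvex_matrixRange {g d : ℕ} (x : MatTuple g d) :
    IsMatrixConvex (matrixRange x) := by
  intro m n s _ _ γ a hγ ha
  choose ψ hcp hone hval using ha
  let φ : operatorSystem x →ₗ[ℂ] Matrix (Fin n) (Fin n) ℂ :=
    { toFun := fun y => ∑ j, (γ j)ᴴ * ψ j y * γ j
      map_add' := fun y z => by
        simp [Matrix.mul_add, Matrix.add_mul, Finset.sum_add_distrib]
      map_smul' := fun c y => by simp [Finset.smul_sum] }
  refine ⟨φ, isCompletelyPositive_sum_conj hcp γ fun _ => rfl, ?_, fun k => ?_⟩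
  · change ∑ j, (γ j)ᴴ * ψ j _ * γ j = 1
    simpa [hone, IsMatrixConvexCoeff] using hγ
  · change ∑ j, (γ j)ᴴ * a j k * γ j = ∑ j, (γ j)ᴴ * ψ j _ * γ j
    simp [hval]

theorem self_mem_matrixRange {g d : ℕ} (x : MatTuple g d) : x ∈ matrixRange x d :=
  ⟨(operatorSystem x).subtype, fun _ _ h => h, rfl, fun _ => rfl⟩

/-- The image of a unitary under a unital completely positive map is a contraction. -/
theorem posSemidef_one_sub_of_mem_matrixRange {g d n : ℕ} {x : MatTuple g d} {k : Fin g}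
    (hx : (x k)ᴴ * x k = 1) {a : MatTuple g n} (ha : a ∈ matrixRange x n) :
    (1 - (a k)ᴴ * a k).PosSemidef := by
  obtain ⟨ψ, hcp, hone, hval⟩ := ha
  let e : operatorSystem x := ⟨1, one_mem_operatorSystem x⟩
  let y : operatorSystem x := ⟨x k, mem_operatorSystem x k⟩
  let z : operatorSystem x := ⟨(x k)ᴴ, Submodule.subset_span (Or.inr ⟨k, rfl⟩)⟩
  -- The block row `[1, x]`: its Gram matrix is `[1, x; x^*, 1]` because `x^* x = 1`.
  let X : Matrix (Fin d) (Fin 2 × Fin d) ℂ := Matrix.of fun i q => (![1, x k] q.1) i q.2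
  have hpos : (Matrix.comp (Fin 2) (Fin 2) (Fin d) (Fin d) ℂ
      ((!![e, y; z, e] : Matrix (Fin 2) (Fin 2) (operatorSystem x)).map
        fun s => (s : Matrix (Fin d) (Fin d) ℂ))).PosSemidef := by
    convert Matrix.posSemidef_conjTranspose_mul_self X using 1
    have hblock : ∀ b c : Fin 2, ∀ i j, (Xᴴ * X) (b, i) (c, j) =
        ((![1, x k] b)ᴴ * ![1, x k] c) i j := fun _ _ _ _ => rfl
    ext ⟨b, i⟩ ⟨c, j⟩
    rw [hblock]
    fin_cases b <;> fin_cases c <;> simp [e, y, z, hx]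
  have h := hcp 2 _ hpos
  have hsub := h.submatrix (Sum.elim (fun i => ((0 : Fin 2), i)) (fun i => ((1 : Fin 2), i)))
  have hfb : (Matrix.comp (Fin 2) (Fin 2) (Fin n) (Fin n) ℂ
      ((!![e, y; z, e] : Matrix (Fin 2) (Fin 2) (operatorSystem x)).map fun s => ψ s)).submatrix
      (Sum.elim (fun i => ((0 : Fin 2), i)) (fun i => ((1 : Fin 2), i)))
      (Sum.elim (fun i => ((0 : Fin 2), i)) (fun i => ((1 : Fin 2), i))) =
      fromBlocks 1 (a k) (ψ z) 1 := by
    ext (i | i) (j | j) <;> simp [e, y, hone, hval]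
  rw [hfb] at hsub
  -- Positivity of the image block matrix makes it Hermitian, which identifies `ψ (x^*)`; the Schur
  -- complement then gives the bound.
  have hz : ψ z = (a k)ᴴ := by
    have := hsub.isHermitian
    rw [Matrix.IsHermitian, fromBlocks_conjTranspose, fromBlocks_inj] at this
    exact this.2.2.1.symm
  let _ : Invertible (1 : Matrix (Fin n) (Fin n) ℂ) := invertibleOne
  rw [hz, Matrix.PosDef.fromBlocks₁₁ _ _ Matrix.PosDef.one] at hsub
  simpa using hsub

/-- If an isometry is a matrix convex combination of contractions `a_j`, then each coefficient
intertwines it with `a_j`, and the weights `γ_j^* γ_j` are invariant under it. -/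
theorem intertwines_of_sum_conj_eq {m n : ℕ} {s : Fin m → ℕ}
    {γ : ∀ j, Matrix (Fin (s j)) (Fin n) ℂ} {a : ∀ j, Matrix (Fin (s j)) (Fin (s j)) ℂ}
    {x : Matrix (Fin n) (Fin n) ℂ} (hγ : ∑ j, (γ j)ᴴ * γ j = 1)
    (ha : ∀ j, (1 - (a j)ᴴ * a j).PosSemidef) (hx : xᴴ * x = 1)
    (hsum : x = ∑ j, (γ j)ᴴ * a j * γ j) (j : Fin m) :
    a j * γ j = γ j * x ∧ xᴴ * ((γ j)ᴴ * γ j) * x = (γ j)ᴴ * γ j := by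
  have hD : ∀ j, ((γ j * x - a j * γ j)ᴴ * (γ j * x - a j * γ j)).PosSemidef :=
    fun j => posSemidef_conjTranspose_mul_self _
  have hE : ∀ j, ((γ j)ᴴ * (1 - (a j)ᴴ * a j) * γ j).PosSemidef :=
    fun j => (ha j).conjTranspose_mul_mul_same _
  have hF := fun j => (hD j).add (hE j)
  have hsum' : xᴴ = ∑ j, (γ j)ᴴ * (a j)ᴴ * γ j := by
    conv_lhs => rw [hsum]
    simp [conjTranspose_sum, Matrix.mul_assoc]
  have hzero : ∑ j, ((γ j * x - a j * γ j)ᴴ * (γ j * x - a j * γ j) +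
      (γ j)ᴴ * (1 - (a j)ᴴ * a j) * γ j) = 0 := by
    have hterm : ∀ j, (γ j * x - a j * γ j)ᴴ * (γ j * x - a j * γ j) +
        (γ j)ᴴ * (1 - (a j)ᴴ * a j) * γ j =
        xᴴ * ((γ j)ᴴ * γ j) * x - xᴴ * ((γ j)ᴴ * a j * γ j) -
          ((γ j)ᴴ * (a j)ᴴ * γ j) * x + (γ j)ᴴ * γ j := by
      intro j
      simp only [conjTranspose_sub, conjTranspose_mul, Matrix.sub_mul, Matrix.mul_sub,
        Matrix.mul_assoc, Matrix.one_mul]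
      abel
    rw [Finset.sum_congr rfl fun j _ => hterm j, Finset.sum_add_distrib,
      Finset.sum_sub_distrib, Finset.sum_sub_distrib, ← Matrix.sum_mul, ← Matrix.mul_sum,
      ← Matrix.mul_sum, ← Matrix.sum_mul, ← hsum, ← hsum', hγ]
    simp [hx]
  -- Traces turn a vanishing sum of positive matrices into vanishing nonnegative numbers.
  have htr : ∀ j, ((γ j * x - a j * γ j)ᴴ * (γ j * x - a j * γ j)).trace +
      ((γ j)ᴴ * (1 - (a j)ᴴ * a j) * γ j).trace = 0 := by
    have h0 := congrArg Matrix.trace hzero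
    rw [Matrix.trace_sum, Matrix.trace_zero,
      Finset.sum_eq_zero_iff_of_nonneg fun j _ => (hF j).trace_nonneg] at h0
    intro j
    rw [← Matrix.trace_add]
    exact h0 j (Finset.mem_univ j)
  obtain ⟨h1, h2⟩ := (add_eq_zero_iff_of_nonneg (hD j).trace_nonneg (hE j).trace_nonneg).1 (htr j)
  have h1' : a j * γ j = γ j * x :=
    (sub_eq_zero.1 (trace_conjTranspose_mul_self_eq_zero_iff.1 h1)).symm
  refine ⟨h1', ?_⟩
  have h2' := (hE j).trace_eq_zero_iff.1 h2
  have h3 : (γ j)ᴴ * (1 - (a j)ᴴ * a j) * γ j = (γ j)ᴴ * γ j - (a j * γ j)ᴴ * (a j * γ j) := by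
    simp [Matrix.mul_sub, Matrix.sub_mul, Matrix.mul_assoc]
  rw [h3, h1', sub_eq_zero] at h2'
  simpa [Matrix.mul_assoc] using h2'.symm

theorem weylU_isometry {p : ℕ} (hp : p ≠ 0) {ζ : ℂ} (hζ : IsPrimitiveRoot ζ p) :
    (weylU p ζ)ᴴ * weylU p ζ = 1 := by
  have hn : ‖ζ‖ = 1 := hζ.norm'_eq_one hp
  have h1 : star ζ * ζ = 1 := by
    simpa [hn] using Complex.conj_mul' ζ
  rw [weylU, diagonal_conjTranspose, diagonal_mul_diagonal, ← diagonal_one]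
  congr 1
  funext i
  simp only [Pi.star_apply, star_pow, ← mul_pow, h1, one_pow]

theorem weylV_isometry (p : ℕ) : (weylV p)ᴴ * weylV p = 1 := by
  ext i j
  have hp : 0 < p := i.pos
  have hinj : ((i : ℕ) + 1) % p = ((j : ℕ) + 1) % p ↔ i = j := by
    refine ⟨fun h => Fin.ext ?_, fun h => by rw [h]⟩
    have := Nat.ModEq.add_right_cancel' 1 (h : (i : ℕ) + 1 ≡ j + 1 [MOD p])
    rwa [Nat.ModEq, Nat.mod_eq_of_lt i.2, Nat.mod_eq_of_lt j.2] at this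
  rw [Matrix.mul_apply, Finset.sum_eq_single ⟨((i : ℕ) + 1) % p, Nat.mod_lt _ hp⟩]
  · simp [weylV, Matrix.one_apply, hinj]
  · intro b _ hb
    have : (b : ℕ) ≠ ((i : ℕ) + 1) % p := fun h => hb (Fin.ext h)
    simp [weylV, this]
  · simp

/-- The Weyl pair is irreducible. -/
theorem eq_scalar_of_commute_weyl {p : ℕ} {ζ : ℂ} (hζ : IsPrimitiveRoot ζ p)
    {A : Matrix (Fin p) (Fin p) ℂ} (hU : weylU p ζ * A = A * weylU p ζ)
    (hV : weylV p * A = A * weylV p) : ∃ c : ℂ, A = c • 1 := by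
  rcases Nat.eq_zero_or_pos p with rfl | hp
  · exact ⟨0, Subsingleton.elim _ _⟩
  -- The eigenvalues of `𝔲` are distinct.
  have hoff : ∀ i j, i ≠ j → A i j = 0 := by
    intro i j hij
    have h := congrFun (congrFun hU i) j
    rw [weylU, diagonal_mul, mul_diagonal, mul_comm] at h
    by_contra h0
    exact hij (Fin.ext (hζ.pow_inj i.2 j.2 (mul_left_cancel₀ h0 h)))
  have hA : A = diagonal fun i => A i i := by
    ext i j
    by_cases hij : i = j
    · subst hij; simp
    · rw [diagonal_apply_ne _ hij, hoff i j hij]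
  -- The shift carries each diagonal entry to the next.
  have hconst : ∀ (k : ℕ) (hk : k < p), A ⟨k, hk⟩ ⟨k, hk⟩ = A ⟨0, hp⟩ ⟨0, hp⟩ := by
    intro k
    induction k with
    | zero => intro _; rfl
    | succ k ih =>
      intro hk
      have h := congrFun (congrFun hV ⟨k + 1, hk⟩) ⟨k, by omega⟩
      rw [hA, diagonal_mul, mul_diagonal] at h
      rw [← ih (by omega)]
      simpa [weylV, Nat.mod_eq_of_lt hk] using h.symm
  refine ⟨A ⟨0, hp⟩ ⟨0, hp⟩, ?_⟩
  rw [hA, smul_one_eq_diagonal]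
  congr 1
  funext i
  simpa using hconst i i.2

/-- Surjectivity onto a nonzero space forces `c ≠ 0`, so `γ` is bijective and `c^(-1/2) γ` is the
unitary. -/
theorem unitarilyEquivalent_of_intertwines {g n d : ℕ} (hn : 0 < n)
    {γ : Matrix (Fin n) (Fin d) ℂ} (hsurj : Function.Surjective γ.mulVec) {c : ℂ}
    (hc : γᴴ * γ = c • 1) {a : MatTuple g n} {b : MatTuple g d}
    (hab : ∀ k, a k * γ = γ * b k) : n = d ∧ UnitarilyEquivalent a b := by
  have hγ0 : γ ≠ 0 := by
    rintro rfl
    obtain ⟨y, hy⟩ := hsurj fun _ => 1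
    have := congrFun hy ⟨0, hn⟩
    simp at this
  have hc0 : c ≠ 0 := by
    rintro rfl
    rw [zero_smul] at hc
    exact hγ0 (conjTranspose_mul_self_eq_zero.1 hc)
  have hinj : Function.Injective γ.mulVec := by
    intro y z hyz
    have h := congrArg (γᴴ.mulVec) hyz
    simp only [Matrix.mulVec_mulVec, hc, Matrix.smul_mulVec, Matrix.one_mulVec] at h
    exact smul_right_injective _ hc0 h
  have hdim : n = d := by
    have h := (LinearEquiv.ofBijective γ.mulVecLin ⟨hinj, hsurj⟩).finrank_eq
    simpa using h.symm
  subst hdim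
  have hcpos : 0 ≤ c := by
    have h := (posSemidef_conjTranspose_mul_self γ).diag_nonneg (i := ⟨0, hn⟩)
    simpa [hc] using h
  obtain ⟨r, hr, rfl⟩ : ∃ r : ℝ, 0 ≤ r ∧ (r : ℂ) = c :=
    ⟨c.re, (Complex.le_def.1 hcpos).1, (Complex.eq_re_of_ofReal_le hcpos).symm⟩
  have hr0 : r ≠ 0 := by simpa using hc0
  have hsq : ((√r : ℝ) : ℂ)⁻¹ * ((√r : ℝ) : ℂ)⁻¹ * (r : ℂ) = 1 := by
    have : (√r)⁻¹ * (√r)⁻¹ * r = 1 := by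
      rw [← mul_inv, Real.mul_self_sqrt hr, inv_mul_cancel₀ hr0]
    exact_mod_cast this
  set t : ℂ := ((√r : ℝ) : ℂ)⁻¹ with ht
  have hts : star t = t := by simp [ht]
  have hw : (t • γ)ᴴ * (t • γ) = 1 := by
    rw [conjTranspose_smul, hts, smul_mul_smul_comm, hc, smul_smul, hsq, one_smul]
  refine ⟨rfl, rfl, t • γ, mem_unitaryGroup_iff'.2 hw, fun k => ?_⟩
  have : Matrix.reindex (finCongr rfl) (finCongr rfl) (a k) = a k := by ext; simp
  rw [this, Matrix.mul_assoc, Matrix.mul_smul, hab, ← Matrix.smul_mul, ← Matrix.mul_assoc, hw,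
    Matrix.one_mul]

theorem weylPair_isometry {p : ℕ} (hp : p ≠ 0) {ζ : ℂ} (hζ : IsPrimitiveRoot ζ p) (k : Fin 2) :
    (weylPair p ζ k)ᴴ * weylPair p ζ k = 1 := by
  fin_cases k
  · exact weylU_isometry hp hζ
  · exact weylV_isometry p

end WeylUnitaries

open WeylUnitaries Matrix in
theorem mainTheorem4 (p : ℕ) (hp : 2 ≤ p) (ζ : ℂ) (hζ : IsPrimitiveRoot ζ p) :
    WeylUnitaries.IsMatrixExtremePoint
      (WeylUnitaries.matrixRange (WeylUnitaries.weylPair p ζ))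
      (WeylUnitaries.weylPair p ζ) := by
  refine ⟨isMatrixConvex_matrixRange _, by omega, self_mem_matrixRange _, ?_⟩
  intro m s hs γ a hγ ha hsurj hb j
  have hiso := weylPair_isometry (by omega) hζ
  have key := fun k => intertwines_of_sum_conj_eq hγ
    (fun j => posSemidef_one_sub_of_mem_matrixRange (hiso k) (ha j)) (hiso k) (congrFun hb k) j
  have hcomm : ∀ k, weylPair p ζ k * ((γ j)ᴴ * γ j) = (γ j)ᴴ * γ j * weylPair p ζ k := by
    intro k
    -- Multiply `x^* Q x = Q` on the left by `x`, using `x x^* = 1`.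
    conv_lhs => rw [← (key k).2]
    rw [← Matrix.mul_assoc, ← Matrix.mul_assoc, mul_eq_one_comm.1 (hiso k), Matrix.one_mul]
  obtain ⟨c, hc⟩ := eq_scalar_of_commute_weyl hζ (hcomm 0) (hcomm 1)
  exact unitarilyEquivalent_of_intertwines (hs j) (hsurj j) hc fun k => (key k).1
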